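/- Let $0<\alpha\le\beta$ be real numbers with $\alpha+\beta\ne 1$. Then there exist a proper interval $I\subseteq\mathbb R$ (an interval with nonempty interior), a set $H'\subseteq\mathbb R$ with $\alpha s+\beta t\in H'$ for all $s,t\in H'$, and a strictly increasing bijection $f:I\to H'$ such that the operation $$F:I^2\to I,\qquad F(x,y)=f^{-1}\bigl(\alpha f(x)+\beta f(y)\bigr),$$ has the following properties. 1. $F$ is bisymmetric, i.e. $F(F(x,y),F(u,v))=F(F(x,u),F(y,v))$ for all $x,y,u,v\in I$. 2. $F$ is partially strictly increasing: for all $x_0,y_0\in I$ the sections $F(x_0,\cdot)$ and $F(\cdot,y_0)$ are strictly increasing on $I$. 3. If $\alpha=\beta$, then $F$ is symmetric: $F(x,y)=F(y,x)$ for all $x,y\in I$. 4. $F$ is not continuous on $I^2$; more precisely, for all $x_0,y_0\in I$ neither of the sections $F(x_0,\cdot)$, $F(\cdot,y_0)$ is continuous on $I$. 5. If $\alpha\ge 1$, then in addition $H'=H\setminus R$, where: $H_0\subseteq[1,2]$ is a nonempty compact perfect nowhere dense set that is linearly independent over the field $\mathbb Q(\alpha,\beta)$; $H=\bigcup_{i\ge0}H_i$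 with $H_{i+1}=H_i\cup\{\alpha s+\beta t: s,t\in H_i\}$; $H$ is perfect (closed without isolated points) and nowhere dense; and $R$ is the set of right endpoints of the connected components of $\mathbb R\setminus H$. -/

import Mathlib

namespace BisymmetricOperation

/-- A proper interval of the real line: an order-convex set with nonempty interior. -/
def IsProperInterval (I : Set ℝ) : Prop :=
  I.OrdConnected ∧ (interior I).Nonempty

/-- The bisymmetry equation for a binary operation. -/
def Bisymmetric {X : Type*} (F : X → X → X) : Prop :=
  ∀ x y u v : X, F (F x y) (F u v) = F (F x u) (F y v)

/-- A binary operation that is strictly increasing in each variable separately. -/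
def PartiallyStrictlyIncreasing {X : Type*} [Preorder X] (F : X → X → X) : Prop :=
  (∀ x₀ : X, StrictMono (fun y => F x₀ y)) ∧ (∀ y₀ : X, StrictMono (fun x => F x y₀))

/-- A symmetric (commutative) binary operation. -/
def SymmetricOp {X : Type*} (F : X → X → X) : Prop :=
  ∀ x y : X, F x y = F y x

/-- The operation `F(x, y) = f⁻¹(α f(x) + β f(y))` on `I`, where `f` is a strictly increasing
bijection from `I` onto a set `S` that is closed under `(s, t) ↦ α s + β t`. -/
def weightedQuasiSum {I S : Set ℝ} (α β : ℝ) (f : I ≃o S)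
    (hS : ∀ s ∈ S, ∀ t ∈ S, α * s + β * t ∈ S) : I → I → I :=
  fun x y => f.symm ⟨α * (f x : ℝ) + β * (f y : ℝ), hS _ (f x).2 _ (f y).2⟩

/-- The layers `H₀` and `Hᵢ₊₁ = Hᵢ ∪ (α Hᵢ + β Hᵢ)`. -/
def layer (α β : ℝ) (H₀ : Set ℝ) : ℕ → Set ℝ
  | 0 => H₀
  | i + 1 => layer α β H₀ i ∪
      Set.image2 (fun s t => α * s + β * t) (layer α β H₀ i) (layer α β H₀ i)

/-- The set generated from `H₀` by iterating `(s, t) ↦ α s + β t`. -/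
def generatedSet (α β : ℝ) (H₀ : Set ℝ) : Set ℝ :=
  ⋃ i : ℕ, layer α β H₀ i

/-- The points of `H` that are right endpoints of an open interval disjoint from `H`; for a closed
set `H`, these are the right endpoints of the (bounded or unbounded) components of the
complement of `H`. -/
def rightEndpoints (H : Set ℝ) : Set ℝ :=
  {b | b ∈ H ∧ ∃ a < b, Disjoint (Set.Ioo a b) H}

/-- `H₀` is a nonempty compact perfect nowhere dense set of reals that is linearly independent
over the field `K`. -/
structure IsIndependentCantorSet (K : Subfield ℝ) (H₀ : Set ℝ) : Prop where
  nonempty : H₀.Nonempty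
  isCompact : IsCompact H₀
  perfect : Perfect H₀
  isNowhereDense : IsNowhereDense H₀
  linearIndependent : LinearIndependent K (fun u : H₀ => (u : ℝ))

end BisymmetricOperation

namespace BisymmetricOperation

open Set Filter Topology

/-! Everything reduces to choosing the set `S = H'`. Bisymmetry, monotonicity and symmetry pass from
`α s + β t` to `F` through `f`. If `S` is order isomorphic to the line, take `I = ℝ`. A continuous
section would have order-convex range by the intermediate value theorem, so it suffices that each
set `α s + β S` and `β s + α S` jumps over an element of `S` (`SectionsHaveGaps`).

When `α < 1`, a union of two intervals separated by a gap is enough. When `α ≥ 1`, `S` is the set of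
left limit points of the set `H` generated by an independent Cantor set `H₀`; dropping right
endpoints of gaps removes the order jumps. Elements of `H` are nonnegative combinations of `H₀`, so
no cancellation occurs: if one section hit suitable multiples of two different members of `H₀`, then
`s = 0`, although `s ≥ 1` on `H`. Closedness of `H` comes from its layers being locally finite in
effect, nowhere density from a proper span. -/

/-! ### Subsets of the reals of the order type of the line -/

/-- A set of reals in which every point is a limit from the left, without a maximum, and containing
the suprema of its subsets without maximum that are bounded in it, is order isomorphic to the real line. -/
theorem nonempty_orderIso_univ {S : Set ℝ} (hne : S.Nonempty)
    (hleft : ∀ s ∈ S, ∀ a < s, ∃ t ∈ S, a < t ∧ t < s)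
    (hmax : ∀ s ∈ S, ∃ t ∈ S, s < t)
    (hsup : ∀ A ⊆ S, A.Nonempty → (∃ s ∈ S, s ∈ upperBounds A) →
      (∀ a ∈ A, ∃ b ∈ A, a < b) → sSup A ∈ S) :
    Nonempty ((univ : Set ℝ) ≃o S) := by
  obtain ⟨D, hDc, hDd⟩ := TopologicalSpace.exists_countable_dense S
  have hD : ∀ s ∈ S, ∀ a < s, ∃ d : D, a < (d : S) ∧ ((d : S) : ℝ) < s := by
    intro s hs a has
    obtain ⟨t, ht, h1, h2⟩ := hleft s hs a has
    obtain ⟨d, hd', hd⟩ := hDd.exists_mem_open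
      (isOpen_Ioo.preimage continuous_subtype_val : IsOpen ((↑) ⁻¹' Ioo a s : Set S))
      ⟨⟨t, ht⟩, h1, h2⟩
    exact ⟨⟨d, hd'⟩, hd⟩
  have : Countable D := hDc.to_subtype
  have : Nonempty D := by
    obtain ⟨s, hs⟩ := hne
    obtain ⟨d, -⟩ := hD s hs (s - 1) (by linarith)
    exact ⟨d⟩
  have : DenselyOrdered D := ⟨fun a b hab => by
    obtain ⟨d, h1, h2⟩ := hD b b.1.2 a hab
    exact ⟨d, h1, h2⟩⟩
  have : NoMinOrder D := ⟨fun b => by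
    obtain ⟨d, -, h2⟩ := hD b b.1.2 (b - 1) (by linarith)
    exact ⟨d, h2⟩⟩
  have : NoMaxOrder D := ⟨fun b => by
    obtain ⟨t, ht, h1⟩ := hmax b b.1.2
    obtain ⟨d, h2, -⟩ := hD t ht b h1
    exact ⟨d, h2⟩⟩
  obtain ⟨e⟩ := Order.iso_of_countable_dense D ℚ
  -- Dedekind cuts extend Cantor's isomorphism `D ≃o ℚ` to the reals. The strict inequality leaves
  -- `A x` without a maximum, as `hsup` demands.
  set A : ℝ → Set ℝ := fun x => (fun d : D => ((d : S) : ℝ)) '' {d | (e d : ℝ) < x} with hA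
  have hAS : ∀ x, A x ⊆ S := by
    rintro x _ ⟨d, -, rfl⟩
    exact d.1.2
  have hApp : ∀ (x : ℝ) (q : ℚ), x < q → ((e.symm q : S) : ℝ) ∈ upperBounds (A x) := by
    rintro x q hq _ ⟨d, hd, rfl⟩
    have : e d ≤ q := by exact_mod_cast (lt_trans (show (e d : ℝ) < x from hd) hq).le
    exact (e.le_symm_apply.2 this : d ≤ e.symm q)
  have hAmem : ∀ (x : ℝ) (q : ℚ), (q : ℝ) < x → ((e.symm q : S) : ℝ) ∈ A x := fun x q hq =>
    ⟨e.symm q, by simpa using hq, rfl⟩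
  have hAbdd' : ∀ x, ∃ s ∈ S, s ∈ upperBounds (A x) := fun x => by
    obtain ⟨q, hq⟩ := exists_rat_gt x
    exact ⟨_, Subtype.coe_prop _, hApp x q hq⟩
  have hAbdd : ∀ x, BddAbove (A x) := fun x =>
    let ⟨s, _, hs⟩ := hAbdd' x
    ⟨s, hs⟩
  have hAne : ∀ x, (A x).Nonempty := fun x => by
    obtain ⟨q, hq⟩ := exists_rat_lt x
    exact ⟨_, hAmem x q hq⟩
  have hAnomax : ∀ x, ∀ a ∈ A x, ∃ b ∈ A x, a < b := by
    rintro x _ ⟨d, hd, rfl⟩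
    obtain ⟨q, h1, h2⟩ := exists_rat_btwn (show (e d : ℝ) < x from hd)
    refine ⟨_, hAmem x q h2, ?_⟩
    have : e d < q := by exact_mod_cast h1
    exact (e.lt_symm_apply.2 this : d < e.symm q)
  let f : ℝ → S := fun x => ⟨sSup (A x), hsup _ (hAS x) (hAne x) (hAbdd' x) (hAnomax x)⟩
  have hf : StrictMono f := by
    intro x y hxy
    obtain ⟨q, h1, h2⟩ := exists_rat_btwn hxy
    obtain ⟨r, h3, h4⟩ := exists_rat_btwn h2
    have h5 : sSup (A x) ≤ (e.symm q : S) := csSup_le (hAne x) (hApp x q h1)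
    have h6 : ((e.symm r : S) : ℝ) ≤ sSup (A y) := le_csSup (hAbdd y) (hAmem y r h4)
    have h7 : e.symm q < e.symm r := e.symm.strictMono (by exact_mod_cast h3)
    have h8 : ((e.symm q : S) : ℝ) < (e.symm r : S) := h7
    exact (by linarith : sSup (A x) < sSup (A y))
  have hfs : Function.Surjective f := by
    rintro ⟨s, hs⟩
    set B : Set ℝ := (fun d : D => (e d : ℝ)) '' {d | ((d : S) : ℝ) < s} with hB
    have hBne : B.Nonempty := by
      obtain ⟨d, -, h2⟩ := hD s hs (s - 1) (by linarith)
      exact ⟨_, d, h2, rfl⟩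
    obtain ⟨t, ht, hst⟩ := hmax s hs
    obtain ⟨d₁, h1, -⟩ := hD t ht s hst
    have hBbdd : BddAbove B := by
      refine ⟨(e d₁ : ℝ), ?_⟩
      rintro _ ⟨d, hd, rfl⟩
      have : d < d₁ := show ((d : S) : ℝ) < (d₁ : S) from lt_trans hd h1
      have := e.strictMono this
      exact (Rat.cast_lt.2 this).le
    refine ⟨sSup B, Subtype.ext ?_⟩
    -- The cut at `sSup B` is exactly the part of `D` below `s`; that part has no maximum because
    -- `s` is a limit from the left.
    have hlt : ∀ d : D, (e d : ℝ) < sSup B ↔ ((d : S) : ℝ) < s := by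
      intro d
      constructor
      · intro h
        obtain ⟨_, ⟨d', hd', rfl⟩, h'⟩ := exists_lt_of_lt_csSup hBne h
        have h'' : e d < e d' := Rat.cast_lt.1 h'
        have h3 : d < d' := e.lt_iff_lt.1 h''
        exact lt_trans (show ((d : S) : ℝ) < (d' : S) from h3) hd'
      · intro h
        obtain ⟨d', h1, h2⟩ := hD s hs d h
        have h3 : e d < e d' := e.strictMono h1
        have h4 : (e d : ℝ) < e d' := by exact_mod_cast h3
        exact lt_of_lt_of_le h4 (le_csSup hBbdd ⟨d', h2, rfl⟩)
    change sSup (A (sSup B)) = s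
    refine csSup_eq_of_forall_le_of_forall_lt_exists_gt (hAne _) ?_ ?_
    · rintro _ ⟨d, hd, rfl⟩
      exact ((hlt d).1 hd).le
    · intro w hw
      obtain ⟨d, h1, h2⟩ := hD s hs w hw
      exact ⟨_, ⟨d, (hlt d).2 h2, rfl⟩, h1⟩
  exact ⟨OrderIso.Set.univ.trans (hf.orderIsoOfSurjective f hfs)⟩

/-! ### Weighted quasi-sums and discontinuity from jumps -/

section weightedQuasiSum

variable {I S : Set ℝ} {α β : ℝ} (f : I ≃o S)
  (hS : ∀ s ∈ S, ∀ t ∈ S, α * s + β * t ∈ S)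

theorem apply_weightedQuasiSum (x y : I) :
    (f (weightedQuasiSum α β f hS x y) : ℝ) = α * f x + β * f y := by
  simp [weightedQuasiSum]

theorem bisymmetric_weightedQuasiSum : Bisymmetric (weightedQuasiSum α β f hS) := by
  intro x y u v
  apply f.injective
  apply Subtype.ext
  simp only [apply_weightedQuasiSum]
  ring

theorem partiallyStrictlyIncreasing_weightedQuasiSum (hα : 0 < α) (hβ : 0 < β) :
    PartiallyStrictlyIncreasing (weightedQuasiSum α β f hS) := by
  refine ⟨fun x₀ y y' h => ?_, fun y₀ x x' h => ?_⟩
  · rw [← f.lt_iff_lt, ← Subtype.coe_lt_coe, apply_weightedQuasiSum, apply_weightedQuasiSum]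
    have : (f y : ℝ) < f y' := f.strictMono h
    gcongr
  · rw [← f.lt_iff_lt, ← Subtype.coe_lt_coe, apply_weightedQuasiSum, apply_weightedQuasiSum]
    have : (f x : ℝ) < f x' := f.strictMono h
    gcongr

/-- If the values of a continuous self-map of an interval are transported to `S`, then they
form an order-convex subset of `S`. -/
theorem exists_apply_eq_of_continuous (hI : I.OrdConnected) {φ : I → I} (hφ : Continuous φ)
    {w : ℝ} (hw : w ∈ S) (h₁ : ∃ y, (f (φ y) : ℝ) ≤ w) (h₂ : ∃ y, w ≤ f (φ y)) :
    ∃ y, (f (φ y) : ℝ) = w := by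
  have : PreconnectedSpace I := Subtype.preconnectedSpace hI.isPreconnected
  obtain ⟨y₁, h₁⟩ := h₁
  obtain ⟨y₂, h₂⟩ := h₂
  obtain ⟨y, hy⟩ := mem_range_of_exists_le_of_exists_ge hφ (c := f.symm ⟨w, hw⟩)
    ⟨y₁, f.le_symm_apply.2 h₁⟩ ⟨y₂, f.symm_apply_le.2 h₂⟩
  exact ⟨y, by simp [hy]⟩

end weightedQuasiSum

/-- For every `s ∈ S`, the values `a s + b t` with `t ∈ S` jump over some element of `S`. -/
def SectionsHaveGaps (a b : ℝ) (S : Set ℝ) : Prop :=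
  ∀ s ∈ S, ∃ w ∈ S, (∃ t ∈ S, a * s + b * t ≤ w) ∧ (∃ t ∈ S, w ≤ a * s + b * t) ∧
    ∀ t ∈ S, a * s + b * t ≠ w

/-- `S` is the range of the generator of a weighted quasi-sum on an interval that has all
the order properties in question, but no continuous section. -/
def GeneratesDiscontinuousQuasiSum (α β : ℝ) (S : Set ℝ) : Prop :=
  ∃ (I : Set ℝ) (f : I ≃o S) (hS : ∀ s ∈ S, ∀ t ∈ S, α * s + β * t ∈ S) (F : I → I → I),
    IsProperInterval I ∧
    F = weightedQuasiSum α β f hS ∧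
    Bisymmetric F ∧
    PartiallyStrictlyIncreasing F ∧
    (α = β → SymmetricOp F) ∧
    ¬ Continuous (fun p : I × I => F p.1 p.2) ∧
    (∀ x₀ : I, ¬ Continuous (fun y : I => F x₀ y)) ∧
    (∀ y₀ : I, ¬ Continuous (fun x : I => F x y₀))

theorem generatesDiscontinuousQuasiSum {α β : ℝ} (hα : 0 < α) (hβ : 0 < β) {S : Set ℝ}
    (hS : ∀ s ∈ S, ∀ t ∈ S, α * s + β * t ∈ S) (hne : S.Nonempty)
    (hleft : ∀ s ∈ S, ∀ a < s, ∃ t ∈ S, a < t ∧ t < s)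
    (hmax : ∀ s ∈ S, ∃ t ∈ S, s < t)
    (hsup : ∀ A ⊆ S, A.Nonempty → (∃ s ∈ S, s ∈ upperBounds A) →
      (∀ a ∈ A, ∃ b ∈ A, a < b) → sSup A ∈ S)
    (hgap₁ : SectionsHaveGaps α β S) (hgap₂ : SectionsHaveGaps β α S) :
    GeneratesDiscontinuousQuasiSum α β S := by
  obtain ⟨f⟩ := nonempty_orderIso_univ hne hleft hmax hsup
  have h₁ : ∀ x₀ : (univ : Set ℝ), ¬ Continuous (fun y => weightedQuasiSum α β f hS x₀ y) := by
    intro x₀ hc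
    obtain ⟨w, hw, ⟨t, ht, htw⟩, ⟨t', ht', htw'⟩, hgap⟩ := hgap₁ (f x₀) (f x₀).2
    obtain ⟨y, hy⟩ := exists_apply_eq_of_continuous f ordConnected_univ hc hw
      ⟨f.symm ⟨t, ht⟩, by simpa [apply_weightedQuasiSum] using htw⟩
      ⟨f.symm ⟨t', ht'⟩, by simpa [apply_weightedQuasiSum] using htw'⟩
    exact hgap (f y) (f y).2 (by rw [← hy, apply_weightedQuasiSum])
  have h₂ : ∀ y₀ : (univ : Set ℝ), ¬ Continuous (fun x => weightedQuasiSum α β f hS x y₀) := by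
    intro y₀ hc
    obtain ⟨w, hw, ⟨t, ht, htw⟩, ⟨t', ht', htw'⟩, hgap⟩ := hgap₂ (f y₀) (f y₀).2
    obtain ⟨y, hy⟩ := exists_apply_eq_of_continuous f ordConnected_univ hc hw
      ⟨f.symm ⟨t, ht⟩, by simpa [apply_weightedQuasiSum, add_comm] using htw⟩
      ⟨f.symm ⟨t', ht'⟩, by simpa [apply_weightedQuasiSum, add_comm] using htw'⟩
    exact hgap (f y) (f y).2 (by rw [← hy, apply_weightedQuasiSum, add_comm])
  refine ⟨univ, f, hS, _, ⟨ordConnected_univ, by simp⟩, rfl, bisymmetric_weightedQuasiSum f hS,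
    partiallyStrictlyIncreasing_weightedQuasiSum f hS hα hβ, ?_, ?_, h₁, h₂⟩
  · rintro rfl x y
    apply f.injective
    apply Subtype.ext
    simp only [apply_weightedQuasiSum]
    ring
  · intro hc
    exact h₁ ⟨0, mem_univ _⟩ (hc.comp (by fun_prop : Continuous fun y : (univ : Set ℝ) =>
      ((⟨0, mem_univ _⟩ : (univ : Set ℝ)), y)))

/-! ### Independent Cantor sets over a countable field -/

/-- The sequence whose terms are computed by `Φ` from the preceding ones. -/
noncomputable def recursiveSeq (Φ : ℕ → (ℕ → ℝ) → ℝ) (n : ℕ) : ℝ :=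
  Φ n fun j => if _h : j < n then recursiveSeq Φ j else 0
termination_by n

/-- Strong recursion with choice: by `hQ`, condition `n` sees only the terms before `n`, so the
default value 0 at later indices is harmless. -/
theorem exists_seq_forall_of_forall_exists {Q : ℕ → (ℕ → ℝ) → ℝ → Prop}
    (hQ : ∀ n g g' y, (∀ j < n, g j = g' j) → Q n g y → Q n g' y)
    (h : ∀ n g, ∃ y, Q n g y) : ∃ a : ℕ → ℝ, ∀ n, Q n a (a n) := by
  choose Φ hΦ using h
  refine ⟨recursiveSeq Φ, fun n => ?_⟩
  have := hΦ n fun j => if j < n then recursiveSeq Φ j else 0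
  rw [recursiveSeq]
  exact hQ n _ _ _ (fun j hj => by simp [hj]) this

/-- A positive sequence decreasing so rapidly that no series `∑ cₙ aₙ` vanishes if the `cₙ` are
taken from a finite subset of `range κ` and infinitely many of them are nonzero. -/
theorem exists_seq_tsum_ne_zero (κ : ℕ → ℝ) :
    ∃ a : ℕ → ℝ, (∀ n, 0 < a n) ∧ (∀ n, a n ≤ (1 / 2) ^ n) ∧ a 0 = 1 ∧
      ∀ (i : ℕ → ℕ) (N : ℕ), (∀ n, i n ≤ N) → (∃ᶠ n in atTop, κ (i n) ≠ 0) →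
        ∑' n, κ (i n) * a n ≠ 0 := by
  let M : ℕ → ℝ := fun m => ∑ i ∈ Finset.range (m + 1), |κ i|
  -- Each nonzero sum of the first `m ≤ n` terms, with coefficients among `κ 0, …, κ m`, must
  -- dominate the new term `y`. There are finitely many such sums, so every small positive `y`
  -- works.
  let Q : ℕ → (ℕ → ℝ) → ℝ → Prop := fun n g y =>
    0 < y ∧ y ≤ (1 / 2) ^ n ∧ (n = 0 → y = 1) ∧
      ∀ (m : Fin (n + 1)) (c : Fin m → Fin (m + 1)),
        ∑ j, κ (c j) * g j ≠ 0 → M m * y ≤ (1 / 2) ^ n * |∑ j, κ (c j) * g j|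
  obtain ⟨a, ha⟩ : ∃ a : ℕ → ℝ, ∀ n, Q n a (a n) := by
    apply exists_seq_forall_of_forall_exists
    · rintro n g g' y hg ⟨h0, h1, h2, h3⟩
      refine ⟨h0, h1, h2, fun m c => ?_⟩
      have : ∑ j, κ (c j) * g' j = ∑ j, κ (c j) * g j :=
        Finset.sum_congr rfl fun j _ => by rw [hg j (by omega)]
      rw [this]
      exact h3 m c
    · rintro (_ | n) g
      · refine ⟨1, one_pos, by simp, fun _ => rfl, fun m c hc => absurd ?_ hc⟩
        have : IsEmpty (Fin m) := ⟨fun j => by have := j.2; omega⟩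
        exact Fintype.sum_empty _
      · have h0 : ∀ᶠ y : ℝ in 𝓝[>] 0, 0 < y := self_mem_nhdsWithin
        have h1 : ∀ᶠ y : ℝ in 𝓝[>] 0, y ≤ (1 / 2) ^ (n + 1) :=
          nhdsWithin_le_nhds (Iic_mem_nhds (by positivity))
        have h3 : ∀ᶠ y : ℝ in 𝓝[>] 0, ∀ (m : Fin (n + 1 + 1)) (c : Fin m → Fin (m + 1)),
            ∑ j, κ (c j) * g j ≠ 0 →
            M m * y ≤ (1 / 2) ^ (n + 1) * |∑ j, κ (c j) * g j| := by
          refine eventually_all.2 fun m => eventually_all.2 fun c => ?_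
          by_cases hc : ∑ j, κ (c j) * g j = 0
          · exact Eventually.of_forall fun y h => absurd hc h
          · have : Tendsto (fun y => M m * y) (𝓝[>] 0) (𝓝 (M m * 0)) :=
              (tendsto_const_nhds.mul tendsto_id).mono_left nhdsWithin_le_nhds
            rw [mul_zero] at this
            filter_upwards [this.eventually_le_const
              (show (0 : ℝ) < (1 / 2) ^ (n + 1) * |∑ j, κ (c j) * g j| by positivity)] with y hy _
            exact hy
        obtain ⟨y, hy0, hy1, hy3⟩ := (h0.and (h1.and h3)).exists
        exact ⟨y, hy0, hy1, fun h => absurd h (by simp), hy3⟩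
  refine ⟨a, fun n => (ha n).1, fun n => (ha n).2.1, (ha 0).2.2.1 rfl, fun i N hi hκ => ?_⟩
  have hgeom : Summable fun n : ℕ => ((1 : ℝ) / 2) ^ n := summable_geometric_two
  have hbound : ∀ m, N ≤ m → ∀ n, |κ (i n)| ≤ M m := fun m hm n =>
    Finset.single_le_sum (f := fun i => |κ i|) (fun _ _ => abs_nonneg _)
      (Finset.mem_range.2 (by have := hi n; omega))
  have hM : ∀ m, 0 ≤ M m := fun m => Finset.sum_nonneg fun _ _ => abs_nonneg _
  have hsum : Summable fun n => κ (i n) * a n := by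
    refine Summable.of_norm_bounded (hgeom.mul_left (M N)) fun n => ?_
    rw [Real.norm_eq_abs, abs_mul, abs_of_pos (ha n).1]
    exact mul_le_mul (hbound N le_rfl n) (ha n).2.1 (ha n).1.le (hM N)
  -- If the partial sum vanishes at an index with nonzero coefficient, the next one does not. Here
  -- `m ≥ N` makes the coefficients admissible, and `m ≥ 2` bounds the tail by half of the partial
  -- sum.
  obtain ⟨m, hmN, hm⟩ : ∃ m, N + 2 ≤ m ∧ ∑ n ∈ Finset.range m, κ (i n) * a n ≠ 0 := by
    obtain ⟨m, hm, hκm⟩ := frequently_atTop.1 hκ (N + 2)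
    by_cases h : ∑ n ∈ Finset.range m, κ (i n) * a n = 0
    · refine ⟨m + 1, by omega, ?_⟩
      rw [Finset.sum_range_succ, h, zero_add]
      exact mul_ne_zero hκm (ha m).1.ne'
    · exact ⟨m, hm, h⟩
  set v := ∑ n ∈ Finset.range m, κ (i n) * a n with hv
  have hterm : ∀ n, |κ (i (n + m)) * a (n + m)| ≤ (1 / 2) ^ n * ((1 / 2) ^ m * |v|) := by
    intro n
    have h1 := (ha (n + m)).2.2.2 ⟨m, by omega⟩
      (fun j => ⟨i j, by have := hi j; simp only; omega⟩)
    simp only [Fin.sum_univ_eq_sum_range (fun j => κ (i j) * a j) m] at h1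
    rw [abs_mul, abs_of_pos (ha _).1, ← mul_assoc, ← pow_add]
    exact (mul_le_mul_of_nonneg_right (hbound m (by omega) _) (ha _).1.le).trans (h1 hm)
  have htail : |∑' n, κ (i (n + m)) * a (n + m)| ≤ 2 * ((1 / 2) ^ m * |v|) :=
    tsum_of_norm_bounded (f := fun n => κ (i (n + m)) * a (n + m))
      (hasSum_geometric_two.mul_right _) hterm
  intro h0
  rw [← hsum.sum_add_tsum_nat_add m, ← hv] at h0
  have hvt : |v| = |∑' n, κ (i (n + m)) * a (n + m)| := by
    rw [eq_neg_of_add_eq_zero_left h0, abs_neg]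
  have hpow : ((1 : ℝ) / 2) ^ m ≤ (1 / 2) ^ 2 :=
    pow_le_pow_of_le_one (by norm_num) (by norm_num) (by omega)
  have hvpos : 0 < |v| := abs_pos.2 hm
  have : (1 / 2 : ℝ) ^ m * |v| ≤ (1 / 2) ^ 2 * |v| := by gcongr
  linarith

/-- The numbers whose binary expansion, without the leading digit, is an initial segment
of `σ`. -/
def prefixCodes (σ : ℕ → Bool) : Set ℕ :=
  {n | ∀ i < Nat.log 2 n, n.testBit i = σ i}

theorem zero_mem_prefixCodes (σ : ℕ → Bool) : 0 ∈ prefixCodes σ := by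
  simp [prefixCodes]

theorem isClopen_setOf_mem_prefixCodes (n : ℕ) : IsClopen {σ | n ∈ prefixCodes σ} := by
  have : {σ | n ∈ prefixCodes σ} =
      ⋂ i ∈ Finset.range (Nat.log 2 n), (fun σ : ℕ → Bool => σ i) ⁻¹' {n.testBit i} := by
    ext σ
    simp [prefixCodes, eq_comm]
  rw [this]
  exact isClopen_biInter_finset fun i _ => (isClopen_discrete _).preimage (continuous_apply i)

theorem infinite_prefixCodes (σ : ℕ → Bool) : (prefixCodes σ).Infinite := by
  refine infinite_of_forall_exists_gt fun k => ?_
  set n := Nat.ofBits fun i : Fin (k + 1) => if (i : ℕ) < k then σ i else true with hn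
  have hlt : n < 2 ^ (k + 1) := Nat.ofBits_lt_two_pow _
  have hbit : ∀ i < k, n.testBit i = σ i := fun i hi => by
    rw [hn, Nat.testBit_ofBits_lt _ i (by omega)]
    simp [hi]
  have hk : n.testBit k = true := by
    rw [hn, Nat.testBit_ofBits_lt _ k (by omega)]
    simp
  have hge : 2 ^ k ≤ n := Nat.ge_two_pow_of_testBit hk
  refine ⟨n, fun i hi => hbit i ?_, k.lt_two_pow_self.trans_le hge⟩
  have := Nat.log_lt_of_lt_pow (b := 2) (by have := k.lt_two_pow_self; omega) hlt
  omega

/-- A code long enough to record the first disagreement found between `σ` and `τ` cannot belong to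
both, so the infinite sets `prefixCodes σ` are almost disjoint. -/
theorem finite_prefixCodes_inter {σ τ : ℕ → Bool} (h : σ ≠ τ) :
    (prefixCodes σ ∩ prefixCodes τ).Finite := by
  obtain ⟨k, hk⟩ := Function.ne_iff.1 h
  refine (finite_lt_nat (2 ^ (k + 1))).subset fun n hn => ?_
  have : Nat.log 2 n ≤ k := by
    by_contra! hlt
    exact hk ((hn.1 k hlt).symm.trans (hn.2 k hlt))
  exact Nat.lt_pow_of_log_lt (by norm_num) (by omega)

-- Take `x σ` to be the sum of `a n` over the codes `n` of `σ`. In a relation with coefficients `g`,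
-- the coefficient of `a n` takes finitely many values and equals `g σ₀` at all but finitely many
-- codes of `σ₀`; the choice of `a` then forbids a zero sum. The bounds come from `a 0 = 1`, as 0 is
-- a code of every `σ`, and from the geometric series.
open scoped Classical in
theorem exists_continuous_linearIndependent (K : Subfield ℝ) [Countable K] :
    ∃ x : (ℕ → Bool) → ℝ, Continuous x ∧ LinearIndependent K x ∧ ∀ σ, x σ ∈ Icc 1 2 := by
  obtain ⟨κ, hκ⟩ := exists_surjective_nat K
  obtain ⟨a, ha, ha', ha0, hne⟩ := exists_seq_tsum_ne_zero fun n => (κ n : ℝ)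
  have hsum : Summable a := Summable.of_nonneg_of_le (fun n => (ha n).le) ha' summable_geometric_two
  have hle : ∀ (σ : ℕ → Bool) n, (prefixCodes σ).indicator a n ≤ a n := fun σ n =>
    indicator_le_self' (fun n _ => (ha n).le) n
  have h0 : ∀ (σ : ℕ → Bool) n, 0 ≤ (prefixCodes σ).indicator a n := fun σ n =>
    indicator_nonneg (fun n _ => (ha n).le) n
  have hs : ∀ σ : ℕ → Bool, Summable ((prefixCodes σ).indicator a) := fun σ => hsum.indicator _
  refine ⟨fun σ => ∑' n, (prefixCodes σ).indicator a n, ?_, ?_, fun σ => ⟨?_, ?_⟩⟩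
  · refine continuous_tsum (fun n => ?_) hsum fun n σ => ?_
    · have : (fun σ : ℕ → Bool => (prefixCodes σ).indicator a n) =
          {σ | n ∈ prefixCodes σ}.indicator fun _ => a n := by
        ext σ
        simp [indicator_apply]
      rw [this]
      exact (isClopen_setOf_mem_prefixCodes n).continuous_indicator continuous_const
    · rw [Real.norm_eq_abs, abs_of_nonneg (h0 σ n)]
      exact hle σ n
  · rw [linearIndependent_iff']
    intro s g hg σ₀ hσ₀
    by_contra hg0
    let c : ℕ → K := fun n => ∑ σ ∈ s with n ∈ prefixCodes σ, g σ
    have hcfin : (range c).Finite := by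
      refine ((s.powerset.image fun t => ∑ σ ∈ t, g σ).finite_toSet).subset ?_
      rintro _ ⟨n, rfl⟩
      exact Finset.mem_coe.2 (Finset.mem_image_of_mem _
        (Finset.mem_powerset.2 (Finset.filter_subset _ _)))
    choose j hj using hκ
    obtain ⟨N, hN⟩ := (hcfin.image j).bddAbove
    refine hne (fun n => j (c n)) N
      (fun n => hN ⟨_, mem_range_self n, rfl⟩) ?_ ?_
    · simp only [hj]
      rw [Nat.frequently_atTop_iff_infinite]
      have hfin : (⋃ σ ∈ s.erase σ₀, prefixCodes σ₀ ∩ prefixCodes σ).Finite :=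
        (s.erase σ₀).finite_toSet.biUnion fun σ hσ =>
          finite_prefixCodes_inter (Finset.ne_of_mem_erase hσ).symm
      refine ((infinite_prefixCodes σ₀).sdiff hfin).mono fun n hn => ?_
      have : c n = g σ₀ := by
        have : s.filter (fun σ => n ∈ prefixCodes σ) = {σ₀} := by
          ext σ
          simp only [Finset.mem_filter, Finset.mem_singleton]
          constructor
          · rintro ⟨h1, h2⟩
            by_contra hσ
            exact hn.2 (mem_biUnion (Finset.mem_coe.2 (Finset.mem_erase.2 ⟨hσ, h1⟩)) ⟨hn.1, h2⟩)
          · rintro rfl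
            exact ⟨hσ₀, hn.1⟩
        simp only [c, this, Finset.sum_singleton]
      simpa [this] using hg0
    · simp only [hj]
      rw [← hg]
      simp only [Subfield.smul_def, smul_eq_mul, ← tsum_mul_left]
      rw [← Summable.tsum_finsetSum fun σ _ => (hs σ).mul_left _]
      refine tsum_congr fun n => ?_
      simp only [c, indicator_apply, mul_ite, mul_zero, ← Finset.sum_filter, ← Finset.sum_mul]
      rw [AddSubmonoidClass.coe_finsetSum]
  · rw [← ha0]
    simpa [zero_mem_prefixCodes] using (hs σ).le_tsum 0 fun n _ => h0 σ n
  · rw [← tsum_geometric_two]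
    exact (hs σ).tsum_le_tsum (fun n => (hle σ n).trans (ha' n)) summable_geometric_two

/-- A countable field of reals admits an independent perfect compact set that does not span the reals. -/
theorem exists_perfect_linearIndependent (K : Subfield ℝ) [Countable K] :
    ∃ H₀ : Set ℝ, H₀ ⊆ Icc 1 2 ∧ H₀.Nonempty ∧ IsCompact H₀ ∧ Perfect H₀ ∧
      LinearIndependent K (fun u : H₀ => (u : ℝ)) ∧ Submodule.span K H₀ ≠ ⊤ := by
  obtain ⟨x, hx, hli, hxI⟩ := exists_continuous_linearIndependent K
  have hC : IsCompact (range x) := isCompact_range hx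
  have hunc : ¬ (range x).Countable := by
    intro h
    have : Countable (ℕ → Bool) := (Equiv.ofInjective x hli.injective).countable_iff.2 h.to_subtype
    have hle : Cardinal.mk (ℕ → Bool) ≤ Cardinal.aleph0 := Cardinal.mk_le_aleph0_iff.2 this
    simp only [Cardinal.mk_arrow, Cardinal.mk_bool, Cardinal.mk_nat, Cardinal.lift_id] at hle
    exact (Cardinal.cantor _).not_ge hle
  obtain ⟨D, hD, hDne, hDx⟩ := exists_perfect_nonempty_of_isClosed_of_not_countable hC.isClosed hunc
  -- Keep only one of two disjoint perfect pieces: a point `p` of the other is independent of it, so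
  -- the span of `C₀` is proper.
  obtain ⟨C₀, C₁, ⟨h₀, hne₀, hC₀⟩, ⟨-, ⟨p, hp⟩, hC₁⟩, hdisj⟩ := hD.splitting hDne
  have hliD : LinearIndepOn K id (range x) := hli.linearIndepOn_id
  refine ⟨C₀, ?_, hne₀, hC.of_isClosed_subset h₀.closed (hC₀.trans hDx), h₀,
    hliD.mono (hC₀.trans hDx), fun htop => ?_⟩
  · rintro _ hu
    obtain ⟨σ, rfl⟩ := hDx (hC₀ hu)
    exact hxI σ
  · have h1 : LinearIndepOn K id (insert p C₀) :=
      hliD.mono (insert_subset (hDx (hC₁ hp)) (hC₀.trans hDx))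
    have h2 := (linearIndepOn_id_insert (hdisj.notMem_of_mem_right hp)).1 h1
    exact h2.2 (htop ▸ Submodule.mem_top)

/-! ### Left limit points of perfect nowhere dense sets -/

section leftLimits

variable {H : Set ℝ}

theorem exists_mem_Ioo_of_mem_diff_rightEndpoints {h a : ℝ} (hh : h ∈ H \ rightEndpoints H)
    (ha : a < h) : ∃ y ∈ H, a < y ∧ y < h := by
  by_contra! hcon
  exact hh.2 ⟨hh.1, a, ha, disjoint_left.2 fun y hy hyH => (hcon y hyH hy.1).not_gt hy.2⟩

theorem mem_diff_rightEndpoints {h : ℝ} (hh : h ∈ H) (hlim : ∀ a < h, ∃ y ∈ H, a < y ∧ y < h) :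
    h ∈ H \ rightEndpoints H := by
  refine ⟨hh, fun ⟨_, a, ha, hdisj⟩ => ?_⟩
  obtain ⟨y, hy, h1, h2⟩ := hlim a ha
  exact disjoint_left.1 hdisj ⟨h1, h2⟩ hy

/-- In a perfect nowhere dense set, the points that are limits from the left are dense. -/
theorem exists_mem_diff_rightEndpoints (hH : Perfect H) (hnd : IsNowhereDense H) {x b : ℝ}
    (hx : x ∈ H) (hxb : x < b) : ∃ u ∈ H \ rightEndpoints H, x ≤ u ∧ u < b := by
  obtain ⟨w, hw, hwH⟩ : ∃ w ∈ Ioo x b, w ∉ H := by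
    by_contra! hcon
    have h1 : Ioo x b ⊆ interior H := interior_maximal hcon isOpen_Ioo
    rw [(hH.closed.isNowhereDense_iff).1 hnd] at h1
    exact (nonempty_Ioo.2 hxb).ne_empty (subset_empty_iff.1 h1)
  have hne : (H ∩ Iic w).Nonempty := ⟨x, hx, hw.1.le⟩
  have hbdd : BddAbove (H ∩ Iic w) := ⟨w, fun y hy => hy.2⟩
  -- The last point of `H` before `w` is isolated from the right, hence, by perfectness, a limit
  -- from the left.
  have hu : sSup (H ∩ Iic w) ∈ H ∩ Iic w := (hH.closed.inter isClosed_Iic).csSup_mem hne hbdd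
  set u := sSup (H ∩ Iic w)
  have huw : u < w := lt_of_le_of_ne hu.2 fun h => hwH (h ▸ hu.1)
  refine ⟨u, mem_diff_rightEndpoints hu.1 fun a ha => ?_, le_csSup hbdd ⟨hx, hw.1.le⟩,
    huw.trans hw.2⟩
  obtain ⟨y, ⟨hyI, hyH⟩, hyu⟩ := preperfect_iff_nhds.1 hH.acc u hu.1 _ (Ioo_mem_nhds ha huw)
  exact ⟨y, hyH, hyI.1, lt_of_le_of_ne (le_csSup hbdd ⟨hyH, hyI.2.le⟩) hyu⟩

theorem exists_mem_diff_rightEndpoints_Ioo (hH : Perfect H) (hnd : IsNowhereDense H) {h a : ℝ}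
    (hh : h ∈ H \ rightEndpoints H) (ha : a < h) :
    ∃ y ∈ H \ rightEndpoints H, a < y ∧ y < h := by
  obtain ⟨y, hy, hay, hyh⟩ := exists_mem_Ioo_of_mem_diff_rightEndpoints hh ha
  obtain ⟨u, hu, hyu, huh⟩ := exists_mem_diff_rightEndpoints hH hnd hy hyh
  exact ⟨u, hu, hay.trans_le hyu, huh⟩

theorem sSup_mem_diff_rightEndpoints (hH : IsClosed H) {A : Set ℝ}
    (hA : A ⊆ H \ rightEndpoints H) (hne : A.Nonempty) (hbdd : BddAbove A)
    (hmax : ∀ a ∈ A, ∃ b ∈ A, a < b) : sSup A ∈ H \ rightEndpoints H := by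
  refine mem_diff_rightEndpoints ?_ fun a ha => ?_
  · exact closure_minimal (fun y hy => (hA hy).1) hH (csSup_mem_closure hne hbdd)
  · obtain ⟨y, hy, hay⟩ := exists_lt_of_lt_csSup hne ha
    obtain ⟨z, hz, hyz⟩ := hmax y hy
    exact ⟨y, (hA hy).1, hay, hyz.trans_le (le_csSup hbdd hz)⟩

theorem rightEndpoints_anti {H₀ : Set ℝ} (h : H₀ ⊆ H) :
    H₀ \ rightEndpoints H₀ ⊆ H \ rightEndpoints H := fun _ hx =>
  mem_diff_rightEndpoints (h hx.1) fun _ ha =>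
    let ⟨y, hy, h1⟩ := exists_mem_Ioo_of_mem_diff_rightEndpoints hx ha
    ⟨y, h hy, h1⟩

end leftLimits

/-! ### Topology and algebra of the generated set -/

section generatedSet

variable {α β : ℝ} {H₀ : Set ℝ}

theorem layer_mono : Monotone (layer α β H₀) :=
  monotone_nat_of_le_succ fun _ => subset_union_left

theorem layer_subset_generatedSet (i : ℕ) : layer α β H₀ i ⊆ generatedSet α β H₀ :=
  subset_iUnion (layer α β H₀) i

theorem subset_generatedSet : H₀ ⊆ generatedSet α β H₀ :=
  layer_subset_generatedSet 0

theorem generatedSet_closed {s t : ℝ} (hs : s ∈ generatedSet α β H₀)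
    (ht : t ∈ generatedSet α β H₀) : α * s + β * t ∈ generatedSet α β H₀ := by
  obtain ⟨i, hi⟩ := mem_iUnion.1 hs
  obtain ⟨j, hj⟩ := mem_iUnion.1 ht
  exact layer_subset_generatedSet (max i j + 1)
    (Or.inr ⟨s, layer_mono (le_max_left i j) hi, t, layer_mono (le_max_right i j) hj, rfl⟩)

theorem generatedSet_induction {p : ℝ → Prop} (h₀ : ∀ s ∈ H₀, p s)
    (h : ∀ s ∈ generatedSet α β H₀, ∀ t ∈ generatedSet α β H₀, p s → p t → p (α * s + β * t))
    {s : ℝ} (hs : s ∈ generatedSet α β H₀) : p s := by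
  obtain ⟨i, hi⟩ := mem_iUnion.1 hs
  clear hs
  induction i generalizing s with
  | zero => exact h₀ s hi
  | succ i ih =>
    obtain hi | ⟨s, hs, t, ht, rfl⟩ := hi
    · exact ih hi
    · exact h s (layer_subset_generatedSet i hs) t (layer_subset_generatedSet i ht) (ih hs) (ih ht)

theorem isCompact_layer (hc : IsCompact H₀) (i : ℕ) : IsCompact (layer α β H₀ i) := by
  induction i with
  | zero => exact hc
  | succ i ih =>
    refine ih.union ?_
    rw [← image_prod]
    exact (ih.prod ih).image (by fun_prop)

theorem one_le_of_mem_generatedSet (hα : 1 ≤ α) (hβ : 1 ≤ β) (h₀ : H₀ ⊆ Icc 1 2) {s : ℝ}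
    (hs : s ∈ generatedSet α β H₀) : 1 ≤ s := by
  refine generatedSet_induction (fun s hs => (h₀ hs).1) (fun s _ t _ h1 h2 => ?_) hs
  nlinarith

/-- With coefficients and elements at least 1, each operand is smaller than `α * s + β * t` by at
least 1. Hence a bounded part of the generated set lies in one layer, which is compact. -/
theorem mem_layer_of_le (hα : 1 ≤ α) (hβ : 1 ≤ β) (h₀ : H₀ ⊆ Icc 1 2) {s : ℝ}
    (hs : s ∈ generatedSet α β H₀) : ∀ n : ℕ, s ≤ n + 1 → s ∈ layer α β H₀ n := by
  refine generatedSet_induction (p := fun s => ∀ n : ℕ, s ≤ n + 1 → s ∈ layer α β H₀ n)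
    (fun s hs n _ => layer_mono n.zero_le hs) (fun s hs t ht ih1 ih2 n hn => ?_) hs
  have h1 := one_le_of_mem_generatedSet hα hβ h₀ hs
  have h2 := one_le_of_mem_generatedSet hα hβ h₀ ht
  have h3 : s ≤ α * s := by nlinarith
  have h4 : t ≤ β * t := by nlinarith
  cases n with
  | zero => norm_num at hn; linarith
  | succ n =>
    push_cast at hn
    exact Or.inr ⟨s, ih1 n (by linarith), t, ih2 n (by linarith), rfl⟩

theorem isClosed_generatedSet (hα : 1 ≤ α) (hβ : 1 ≤ β) (h₀ : H₀ ⊆ Icc 1 2)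
    (hc : IsCompact H₀) : IsClosed (generatedSet α β H₀) := by
  refine isClosed_of_closure_subset fun x hx => ?_
  obtain ⟨n, hn⟩ := exists_nat_gt x
  have h1 : x ∈ closure (Iio (n + 1 : ℝ) ∩ generatedSet α β H₀) :=
    isOpen_Iio.inter_closure ⟨show x < n + 1 by linarith, hx⟩
  refine layer_subset_generatedSet n ((isCompact_layer hc n).isClosed.closure_subset_iff.2 ?_ h1)
  rintro y ⟨hy, hyH⟩
  exact mem_layer_of_le hα hβ h₀ hyH n (le_of_lt hy)

theorem preperfect_generatedSet (hα : α ≠ 0) (h₀ : Preperfect H₀) :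
    Preperfect (generatedSet α β H₀) := by
  intro s hs
  refine generatedSet_induction (fun s hs => (h₀ s hs).mono (principal_mono.2 subset_generatedSet))
    (fun s _ t ht h1 _ => ?_) hs
  rw [accPt_iff_nhds] at h1 ⊢
  intro U hU
  have hcont : Tendsto (fun s => α * s + β * t) (𝓝 s) (𝓝 (α * s + β * t)) :=
    Continuous.tendsto (by fun_prop) s
  obtain ⟨y, ⟨hyU, hyH⟩, hys⟩ := h1 _ (hcont hU)
  exact ⟨_, ⟨hyU, generatedSet_closed hyH ht⟩, by simpa [hα] using hys⟩

theorem generatedSet_subset_span {K : Subfield ℝ} (hα : α ∈ K) (hβ : β ∈ K) :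
    generatedSet α β H₀ ⊆ Submodule.span K H₀ := fun _ hs =>
  generatedSet_induction (fun _ hs => Submodule.subset_span hs)
    (fun _ _ _ _ h1 h2 => Submodule.add_mem _ (Submodule.smul_mem _ (⟨α, hα⟩ : K) h1)
      (Submodule.smul_mem _ (⟨β, hβ⟩ : K) h2)) hs

/-- An additive subgroup of the reals with an interior point is clopen, hence everything. -/
theorem interior_span_eq_empty {K : Subfield ℝ} (h : Submodule.span K H₀ ≠ ⊤) :
    interior (Submodule.span K H₀ : Set ℝ) = ∅ := by
  by_contra! hne
  refine h (eq_top_iff.2 fun x _ => ?_)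
  obtain ⟨y, hy⟩ := hne
  have hopen : IsOpen ((Submodule.span K H₀).toAddSubgroup : Set ℝ) :=
    AddSubgroup.isOpen_of_mem_nhds _ (mem_interior_iff_mem_nhds.1 hy)
  have huniv : ((Submodule.span K H₀).toAddSubgroup : Set ℝ) = univ :=
    IsClopen.eq_univ ⟨AddSubgroup.isClosed_of_isOpen _ hopen, hopen⟩ ⟨0, zero_mem _⟩
  exact (huniv ▸ mem_univ x : x ∈ ((Submodule.span K H₀).toAddSubgroup : Set ℝ))

theorem exists_nonneg_linearCombination {K : Subfield ℝ} (hα : α ∈ K) (hβ : β ∈ K)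
    (hα0 : 0 ≤ α) (hβ0 : 0 ≤ β) {s : ℝ} (hs : s ∈ generatedSet α β H₀) :
    ∃ g : H₀ →₀ K, 0 ≤ g ∧ Finsupp.linearCombination K (fun u : H₀ => (u : ℝ)) g = s := by
  refine generatedSet_induction (p := fun s => ∃ g : H₀ →₀ K, 0 ≤ g ∧
    Finsupp.linearCombination K (fun u : H₀ => (u : ℝ)) g = s)
    (fun s hs => ⟨Finsupp.single ⟨s, hs⟩ 1, ?_, by simp⟩) ?_ hs
  · exact Finsupp.single_nonneg.2 zero_le_one
  · rintro s - t - ⟨g, hg, rfl⟩ ⟨g', hg', rfl⟩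
    refine ⟨(⟨α, hα⟩ : K) • g + (⟨β, hβ⟩ : K) • g', fun u => ?_, ?_⟩
    · exact add_nonneg (mul_nonneg (show (0 : K) ≤ ⟨α, hα⟩ from hα0) (hg u))
        (mul_nonneg (show (0 : K) ≤ ⟨β, hβ⟩ from hβ0) (hg' u))
    · simp [Subfield.smul_def]

/-- If positive combinations of `s` with elements of `H` produce multiples of two different
members of an independent set, then `s = 0`. -/
theorem eq_zero_of_combination_eq_mul {K : Subfield ℝ} (hα : α ∈ K) (hβ : β ∈ K)
    (hα0 : 0 ≤ α) (hβ0 : 0 ≤ β) (hli : LinearIndependent K (fun u : H₀ => (u : ℝ)))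
    {a b : ℝ} (ha : a ∈ K) (hb : b ∈ K) (ha0 : 0 < a) (hb0 : 0 ≤ b)
    {s t t' k k' : ℝ} (hs : s ∈ generatedSet α β H₀) (ht : t ∈ generatedSet α β H₀)
    (ht' : t' ∈ generatedSet α β H₀) (hk : k ∈ K) (hk' : k' ∈ K) {u u' : H₀} (huu : u ≠ u')
    (h : a * s + b * t = k * u) (h' : a * s + b * t' = k' * u') : s = 0 := by
  obtain ⟨g, hg, rfl⟩ := exists_nonneg_linearCombination hα hβ hα0 hβ0 hs
  -- Compare coefficients at `v ≠ u`: two nonnegative terms sum to 0, and `a > 0` gives `g v = 0`.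
  -- Since no index equals both `u` and `u'`, this kills all of `g`.
  have key : ∀ {t k : ℝ} {u : H₀}, t ∈ generatedSet α β H₀ → k ∈ K →
      a * Finsupp.linearCombination K (fun u : H₀ => (u : ℝ)) g + b * t = k * u →
      ∀ v, v ≠ u → g v = 0 := by
    intro t k u ht hk h v hv
    obtain ⟨g', hg', rfl⟩ := exists_nonneg_linearCombination hα hβ hα0 hβ0 ht
    have h1 : (⟨a, ha⟩ : K) • g + (⟨b, hb⟩ : K) • g' = Finsupp.single u (⟨k, hk⟩ : K) := by
      apply hli
      simpa [Subfield.smul_def] using h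
    have h2 := DFunLike.congr_fun h1 v
    rw [Finsupp.single_eq_of_ne hv] at h2
    have h3 : (⟨a, ha⟩ : K) * g v + (⟨b, hb⟩ : K) * g' v = 0 := h2
    have hap : (0 : K) < ⟨a, ha⟩ := ha0
    have hbp : (0 : K) ≤ ⟨b, hb⟩ := hb0
    have h4 : (⟨a, ha⟩ : K) * g v ≤ 0 := by
      have := mul_nonneg hbp (hg' v)
      linarith
    exact le_antisymm (nonpos_of_mul_nonpos_right h4 hap) (hg v)
  have : g = 0 := by
    ext v
    by_cases hv : v = u
    · rw [key ht' hk' h' v (hv ▸ huu)]; rfl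
    · rw [key ht hk h v hv]; rfl
  simp [this]

end generatedSet

/-! ### Two-interval examples -/

/-- On `(1, ∞)` the operation lands above `α + β`, so the gap `(b, α + β]` does no harm to closure.
Each interval omits its left endpoint, so every point is a limit from the left. -/
theorem exists_generates_of_one_lt_add {α β : ℝ} (hα : 0 < α) (hβ : 0 < β) (h : 1 < α + β) :
    ∃ S, GeneratesDiscontinuousQuasiSum α β S := by
  obtain ⟨b, hb, hbc⟩ := exists_between h
  set S : Set ℝ := Ioc 1 b ∪ Ioi (α + β) with hS
  have hlt : ∀ s ∈ S, 1 < s := by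
    rintro s (hs | hs)
    exacts [hs.1, h.trans hs]
  have hop : ∀ {x y : ℝ}, 0 < x → 0 < y → x + y = α + β → ∀ s ∈ S, ∀ t, 1 < t →
      α + β < x * s + y * t := fun hx hy hxy s hs t ht => by
    nlinarith [hlt s hs]
  have hbS : b ∈ S := Or.inl ⟨hb, le_rfl⟩
  have hcS : α + β + 1 ∈ S := Or.inr (by simp)
  have hgap : ∀ {x y : ℝ}, 0 < x → 0 < y → x + y = α + β → SectionsHaveGaps x y S := by
    intro x y hx hy hxy s hs
    -- A point `m` of the gap yields the skipped value: `x * s + y * m` is in `S`, but only `t = m`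
    -- could attain it.
    obtain ⟨m, hbm, hm⟩ := exists_between hbc
    refine ⟨x * s + y * m, Or.inr (hop hx hy hxy s hs m (hb.trans hbm)),
      ⟨b, hbS, by gcongr⟩, ⟨α + β + 1, hcS, by gcongr; linarith⟩, fun t ht heq => ?_⟩
    obtain rfl : t = m := mul_left_cancel₀ hy.ne' (add_left_cancel heq)
    exact ht.elim (fun h => h.2.not_gt hbm) fun h => lt_asymm h hm
  refine ⟨S, generatesDiscontinuousQuasiSum hα hβ
    (fun s hs t ht => Or.inr (hop hα hβ rfl s hs t (hlt t ht))) ⟨b, hbS⟩ ?_ ?_ ?_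
    (hgap hα hβ rfl) (hgap hβ hα (add_comm _ _))⟩
  · rintro s (⟨h1, h2⟩ | h1) a ha
    · obtain ⟨t, ht, hts⟩ := exists_between (max_lt ha h1)
      exact ⟨t, Or.inl ⟨(le_max_right _ _).trans_lt ht, hts.le.trans h2⟩,
        (le_max_left _ _).trans_lt ht, hts⟩
    · obtain ⟨t, ht, hts⟩ := exists_between (max_lt ha h1)
      exact ⟨t, Or.inr ((le_max_right _ _).trans_lt ht), (le_max_left _ _).trans_lt ht, hts⟩
  · rintro s (⟨-, h2⟩ | h1)
    · exact ⟨α + β + 1, hcS, by linarith⟩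
    · exact ⟨s + 1, Or.inr (by simp only [mem_Ioi] at h1 ⊢; linarith), by linarith⟩
  · rintro A hA ⟨y, hy⟩ ⟨u, hu, huA⟩ -
    have hle : ∀ z ∈ A, z ≤ sSup A := fun z hz => le_csSup ⟨u, huA⟩ hz
    by_cases hle' : sSup A ≤ b
    · exact Or.inl ⟨(hlt y (hA hy)).trans_le (hle y hy), hle'⟩
    · obtain ⟨z, hz, hbz⟩ := exists_lt_of_lt_csSup ⟨y, hy⟩ (not_le.1 hle')
      obtain h1 | h1 := hA hz
      · exact absurd h1.2 hbz.not_ge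
      · exact Or.inr (lt_of_lt_of_le h1 (hle z hz))

/-- The mirror case: on `(0, 1)` the operation lands in `(0, α + β)`, below the gap `(α + β, b]`,
and a point of the gap again yields a skipped value. -/
theorem exists_generates_of_add_lt_one {α β : ℝ} (hα : 0 < α) (hβ : 0 < β) (h : α + β < 1) :
    ∃ S, GeneratesDiscontinuousQuasiSum α β S := by
  obtain ⟨b, hbc, hb⟩ := exists_between h
  set S : Set ℝ := Ioc 0 (α + β) ∪ Ioo b 1 with hS
  have hpos : ∀ s ∈ S, 0 < s := by
    rintro s (hs | hs)
    exacts [hs.1, by linarith [hs.1]]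
  have hlt : ∀ s ∈ S, s < 1 := by
    rintro s (hs | hs)
    exacts [hs.2.trans_lt h, hs.2]
  have hop : ∀ {x y : ℝ}, 0 < x → 0 < y → x + y = α + β → ∀ s ∈ S, ∀ t, 0 < t → t < 1 →
      x * s + y * t ∈ S := fun hx hy hxy s hs t ht ht' => by
    have := hpos s hs
    exact Or.inl ⟨by positivity, by nlinarith [hlt s hs]⟩
  have hcS : α + β ∈ S := Or.inl ⟨by positivity, le_rfl⟩
  have hgap : ∀ {x y : ℝ}, 0 < x → 0 < y → x + y = α + β → SectionsHaveGaps x y S := by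
    intro x y hx hy hxy s hs
    obtain ⟨m, hm, hmb⟩ := exists_between hbc
    obtain ⟨m', hm', hmb'⟩ := exists_between hb
    refine ⟨x * s + y * m, hop hx hy hxy s hs m (by linarith) (by linarith),
      ⟨α + β, hcS, by gcongr⟩, ⟨m', Or.inr ⟨hm', hmb'⟩, by gcongr; linarith⟩, fun t ht heq => ?_⟩
    obtain rfl : t = m := mul_left_cancel₀ hy.ne' (add_left_cancel heq)
    exact ht.elim (fun h => h.2.not_gt hm) fun h => lt_asymm h.1 hmb
  refine ⟨S, generatesDiscontinuousQuasiSum hα hβ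
    (fun s hs t ht => hop hα hβ rfl s hs t (hpos t ht) (hlt t ht)) ⟨_, hcS⟩ ?_ ?_ ?_
    (hgap hα hβ rfl) (hgap hβ hα (add_comm _ _))⟩
  · rintro s (⟨h1, h2⟩ | ⟨h1, h2⟩) a ha
    · obtain ⟨t, ht, hts⟩ := exists_between (max_lt ha h1)
      exact ⟨t, Or.inl ⟨(le_max_right _ _).trans_lt ht, hts.le.trans h2⟩,
        (le_max_left _ _).trans_lt ht, hts⟩
    · obtain ⟨t, ht, hts⟩ := exists_between (max_lt ha h1)
      exact ⟨t, Or.inr ⟨(le_max_right _ _).trans_lt ht, hts.trans h2⟩,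
        (le_max_left _ _).trans_lt ht, hts⟩
  · intro s hs
    obtain ⟨t, ht, ht'⟩ := exists_between (max_lt (hlt s hs) hb)
    exact ⟨t, Or.inr ⟨(le_max_right _ _).trans_lt ht, ht'⟩, (le_max_left _ _).trans_lt ht⟩
  · rintro A hA ⟨y, hy⟩ ⟨u, hu, huA⟩ -
    have hle : ∀ z ∈ A, z ≤ sSup A := fun z hz => le_csSup ⟨u, huA⟩ hz
    by_cases hle' : sSup A ≤ α + β
    · exact Or.inl ⟨(hpos y (hA hy)).trans_le (hle y hy), hle'⟩
    · obtain ⟨z, hz, hbz⟩ := exists_lt_of_lt_csSup ⟨y, hy⟩ (not_le.1 hle')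
      obtain h1 | h1 := hA hz
      · exact absurd h1.2 hbz.not_ge
      · exact Or.inr ⟨h1.1.trans_le (hle z hz), (csSup_le ⟨y, hy⟩ huA).trans_lt (hlt u hu)⟩

/-! ### The Cantor-type example for coefficients at least 1 -/

theorem countable_subfield_closure {s : Set ℝ} (hs : s.Countable) :
    Countable (Subfield.closure s) :=
  Cardinal.mk_le_aleph0_iff.1 ((Subfield.cardinalMk_closure_le_max s).trans
    (max_le (Cardinal.mk_le_aleph0_iff.2 hs.to_subtype) le_rfl))

section generatedSet

variable {α β : ℝ} {H₀ : Set ℝ}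

/-- Approximating `s` from the left while fixing `t` approximates the value from the left, so only
`s` has to be a left limit. -/
theorem add_mul_mem_diff_rightEndpoints (hα : 0 < α) {s t : ℝ}
    (hs : s ∈ generatedSet α β H₀ \ rightEndpoints (generatedSet α β H₀))
    (ht : t ∈ generatedSet α β H₀) :
    α * s + β * t ∈ generatedSet α β H₀ \ rightEndpoints (generatedSet α β H₀) := by
  refine mem_diff_rightEndpoints (generatedSet_closed hs.1 ht) fun a ha => ?_
  obtain ⟨y, hy, hay, hys⟩ := exists_mem_Ioo_of_mem_diff_rightEndpoints hs
    (show (a - β * t) / α < s by rw [div_lt_iff₀ hα]; linarith)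
  rw [div_lt_iff₀ hα] at hay
  exact ⟨α * y + β * t, generatedSet_closed hy ht, by linarith, by gcongr⟩

theorem add_pow_mul_mem_diff_rightEndpoints (hα : 0 < α) {s : ℝ}
    (hs : s ∈ generatedSet α β H₀ \ rightEndpoints (generatedSet α β H₀)) (n : ℕ) :
    (α + β) ^ n * s ∈ generatedSet α β H₀ \ rightEndpoints (generatedSet α β H₀) := by
  induction n with
  | zero => simpa using hs
  | succ n ih =>
    convert add_mul_mem_diff_rightEndpoints hα ih ih.1 using 1
    ring

theorem exists_ne_mem_diff_rightEndpoints (hH : Perfect H₀) (hnd : IsNowhereDense H₀)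
    (hne : H₀.Nonempty) : ∃ u u' : H₀, u ≠ u' ∧ (u : ℝ) ∈ H₀ \ rightEndpoints H₀ ∧
      (u' : ℝ) ∈ H₀ \ rightEndpoints H₀ := by
  obtain ⟨x, hx⟩ := hne
  obtain ⟨u, hu, -, -⟩ := exists_mem_diff_rightEndpoints hH hnd hx (lt_add_one x)
  obtain ⟨v, hv, -, hvu⟩ := exists_mem_diff_rightEndpoints_Ioo hH hnd hu (sub_one_lt u)
  exact ⟨⟨u, hu.1⟩, ⟨v, hv.1⟩, fun h => hvu.ne' (congrArg Subtype.val h), hu, hv⟩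

theorem sectionsHaveGaps_diff_rightEndpoints {K : Subfield ℝ} (hα : 1 ≤ α) (hβ : 1 ≤ β)
    (hαK : α ∈ K) (hβK : β ∈ K) (h₀ : H₀ ⊆ Icc 1 2)
    (hli : LinearIndependent K (fun u : H₀ => (u : ℝ))) {u u' : H₀} (huu : u ≠ u')
    (hu : (u : ℝ) ∈ H₀ \ rightEndpoints H₀) (hu' : (u' : ℝ) ∈ H₀ \ rightEndpoints H₀)
    {a b : ℝ} (ha : 1 ≤ a) (hb : 1 ≤ b) (haK : a ∈ K) (hbK : b ∈ K) :
    SectionsHaveGaps a b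
      (generatedSet α β H₀ \ rightEndpoints (generatedSet α β H₀)) := by
  intro s hs
  have hone : ∀ {t}, t ∈ generatedSet α β H₀ → 1 ≤ t := one_le_of_mem_generatedSet hα hβ h₀
  -- For large `n` the candidate `w = (α + β) ^ n * v` exceeds the section's value at `t = s`, since
  -- `v ≥ 1`; the value at `t = w` exceeds `w`, since `b ≥ 1`.
  obtain ⟨n, hn⟩ := pow_unbounded_of_one_lt (a * s + b * s) (show 1 < α + β by linarith)
  have hw : ∀ v : H₀, (v : ℝ) ∈ H₀ \ rightEndpoints H₀ →
      (∀ t ∈ generatedSet α β H₀ \ rightEndpoints (generatedSet α β H₀),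
        a * s + b * t ≠ (α + β) ^ n * v) →
      ∃ w ∈ generatedSet α β H₀ \ rightEndpoints (generatedSet α β H₀),
        (∃ t ∈ generatedSet α β H₀ \ rightEndpoints (generatedSet α β H₀), a * s + b * t ≤ w) ∧
        (∃ t ∈ generatedSet α β H₀ \ rightEndpoints (generatedSet α β H₀), w ≤ a * s + b * t) ∧
        ∀ t ∈ generatedSet α β H₀ \ rightEndpoints (generatedSet α β H₀), a * s + b * t ≠ w := by
    intro v hv hvt
    have hmem := add_pow_mul_mem_diff_rightEndpoints (by linarith : 0 < α)
      (rightEndpoints_anti (subset_generatedSet (α := α) (β := β)) hv) n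
    have h1 := hone hs.1
    have h2 := hone hmem.1
    have h3 := (h₀ v.2).1
    have h4 : (0 : ℝ) ≤ (α + β) ^ n := by positivity
    refine ⟨_, hmem, ⟨s, hs, by nlinarith⟩, ⟨_, hmem, by nlinarith⟩, hvt⟩
  -- At most one of the multiples of `u` and `u'` can be hit, so the other is skipped.
  by_cases h : ∀ t ∈ generatedSet α β H₀ \ rightEndpoints (generatedSet α β H₀),
      a * s + b * t ≠ (α + β) ^ n * u
  · exact hw u hu h
  · refine hw u' hu' fun t' ht' h' => ?_
    push Not at h
    obtain ⟨t, ht, h⟩ := h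
    have hk : (α + β) ^ n ∈ K := pow_mem (add_mem hαK hβK) n
    have := eq_zero_of_combination_eq_mul hαK hβK (by linarith) (by linarith) hli haK hbK
      (by linarith) (by linarith) hs.1 ht.1 ht'.1 hk hk huu h h'
    linarith [hone hs.1]

theorem generates_diff_rightEndpoints {K : Subfield ℝ} (hα : 1 ≤ α) (hβ : 1 ≤ β)
    (hαK : α ∈ K) (hβK : β ∈ K) (h₀ : H₀ ⊆ Icc 1 2) (hH₀ : IsIndependentCantorSet K H₀)
    (hH : Perfect (generatedSet α β H₀)) (hnd : IsNowhereDense (generatedSet α β H₀)) :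
    GeneratesDiscontinuousQuasiSum α β
      (generatedSet α β H₀ \ rightEndpoints (generatedSet α β H₀)) := by
  have hα0 : 0 < α := by linarith
  obtain ⟨u, u', huu, hu, hu'⟩ :=
    exists_ne_mem_diff_rightEndpoints hH₀.perfect hH₀.isNowhereDense hH₀.nonempty
  refine generatesDiscontinuousQuasiSum hα0 (by linarith)
    (fun s hs t ht => add_mul_mem_diff_rightEndpoints hα0 hs ht.1)
    ⟨u, rightEndpoints_anti subset_generatedSet hu⟩
    (fun s hs a ha => exists_mem_diff_rightEndpoints_Ioo hH hnd hs ha)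
    (fun s hs => ⟨_, add_mul_mem_diff_rightEndpoints hα0 hs hs.1, ?_⟩)
    (fun A hA hne ⟨b, _, hb⟩ => sSup_mem_diff_rightEndpoints hH.closed hA hne ⟨b, hb⟩)
    (sectionsHaveGaps_diff_rightEndpoints hα hβ hαK hβK h₀ hH₀.linearIndependent huu hu hu'
      hα hβ hαK hβK)
    (sectionsHaveGaps_diff_rightEndpoints hα hβ hαK hβK h₀ hH₀.linearIndependent huu hu hu'
      hβ hα hβK hαK)
  nlinarith [one_le_of_mem_generatedSet hα hβ h₀ hs.1]

theorem exists_isIndependentCantorSet_generatedSet (hα : 1 ≤ α) (hβ : 1 ≤ β) :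
    ∃ H₀ : Set ℝ, H₀ ⊆ Icc 1 2 ∧ IsIndependentCantorSet (Subfield.closure {α, β}) H₀ ∧
      Perfect (generatedSet α β H₀) ∧ IsNowhereDense (generatedSet α β H₀) := by
  have : Countable (Subfield.closure {α, β}) := countable_subfield_closure (Set.toFinite _).countable
  obtain ⟨H₀, h₀, hne, hc, hp, hli, hspan⟩ :=
    exists_perfect_linearIndependent (Subfield.closure {α, β})
  have hclosed := isClosed_generatedSet hα hβ h₀ hc
  have hnd : IsNowhereDense (generatedSet α β H₀) := by
    rw [hclosed.isNowhereDense_iff, ← subset_empty_iff, ← interior_span_eq_empty hspan]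
    -- Since `α` and `β` lie in the field, the generated set stays in the proper span of `H₀`, whose
    -- interior is empty.
    exact interior_mono (generatedSet_subset_span (Subfield.subset_closure (by simp))
      (Subfield.subset_closure (by simp)))
  exact ⟨H₀, h₀, ⟨hne, hc, hp, hnd.mono subset_generatedSet, hli⟩,
    ⟨hclosed, preperfect_generatedSet (by linarith) hp.acc⟩, hnd⟩

end generatedSet

end BisymmetricOperation

theorem mainTheorem1 (α β : ℝ) (hα : 0 < α) (hαβ : α ≤ β) (hsum : α + β ≠ 1) :
    ∃ (I H' : Set ℝ) (f : I ≃o H') (hH' : ∀ s ∈ H', ∀ t ∈ H', α * s + β * t ∈ H')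
      (F : I → I → I),
      BisymmetricOperation.IsProperInterval I ∧
      F = BisymmetricOperation.weightedQuasiSum α β f hH' ∧
      BisymmetricOperation.Bisymmetric F ∧
      BisymmetricOperation.PartiallyStrictlyIncreasing F ∧
      (α = β → BisymmetricOperation.SymmetricOp F) ∧
      ¬ Continuous (fun p : I × I => F p.1 p.2) ∧
      (∀ x₀ : I, ¬ Continuous (fun y : I => F x₀ y)) ∧
      (∀ y₀ : I, ¬ Continuous (fun x : I => F x y₀)) ∧
      (1 ≤ α → ∃ H₀ : Set ℝ,
        H₀ ⊆ Set.Icc 1 2 ∧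
        BisymmetricOperation.IsIndependentCantorSet (Subfield.closure {α, β}) H₀ ∧
        Perfect (BisymmetricOperation.generatedSet α β H₀) ∧
        IsNowhereDense (BisymmetricOperation.generatedSet α β H₀) ∧
        H' = BisymmetricOperation.generatedSet α β H₀ \
          BisymmetricOperation.rightEndpoints (BisymmetricOperation.generatedSet α β H₀)) := by
  -- The form of `H'` is prescribed only for `α ≥ 1`; otherwise any suitable set will do.
  by_cases h1 : 1 ≤ α
  · have hβ1 : 1 ≤ β := h1.trans hαβ
    obtain ⟨H₀, h₀, hH₀, hp, hnd⟩ :=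
      BisymmetricOperation.exists_isIndependentCantorSet_generatedSet h1 hβ1
    obtain ⟨I, f, hS, F, hI, hF, hb, hm, hs, hc, hx, hy⟩ :=
      BisymmetricOperation.generates_diff_rightEndpoints h1 hβ1
        (Subfield.subset_closure (by simp)) (Subfield.subset_closure (by simp)) h₀ hH₀ hp hnd
    exact ⟨I, _, f, hS, F, hI, hF, hb, hm, hs, hc, hx, hy, fun _ => ⟨H₀, h₀, hH₀, hp, hnd, rfl⟩⟩
  · have hβ : 0 < β := hα.trans_le hαβ
    obtain ⟨S, I, f, hS, F, hI, hF, hb, hm, hs, hc, hx, hy⟩ :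
        ∃ S, BisymmetricOperation.GeneratesDiscontinuousQuasiSum α β S :=
      hsum.lt_or_gt.elim (BisymmetricOperation.exists_generates_of_add_lt_one hα hβ)
        (BisymmetricOperation.exists_generates_of_one_lt_add hα hβ)
    exact ⟨I, S, f, hS, F, hI, hF, hb, hm, hs, hc, hx, hy, fun h => absurd h h1⟩
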